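/- A \emph{vtree} for a finite nonempty set $X$ of variables is a full rooted binary tree whose leaves are in one-to-one correspondence with $X$. An \emph{NNF circuit} on $X$ is an acyclic circuit (gates may be shared) of fan-in-2 $\wedge$-gates and unbounded fan-in $\vee$-gates whose inputs are labeled by literals $x,\overline{x}$ ($x\in X$) and constants $\bot,\top$; its size is its number of gates (input gates included). For a gate $u$, $\mathrm{vars}(u)$ is the set of variables for which a literal appears in the subcircuit rooted at $u$. The circuit is a \emph{structured d-DNNF w.r.t. a vtree $T$} if the children of each $\wedge$-gate have disjoint variable sets, the functions computed at distinct children of each $\vee$-gate are never simultaneously $1$, and for each $\wedge$-gate with children $u_l,u_r$ there is an inner node of $T$ with children $v_l,v_r$ such that $\mathrm{vars}(u_l)$ and $\mathrm{vars}(u_r)$ are contained in the sets of leaf variables below $v_l$ and $v_r$, respectively. It is \emph{smooth} if all children of an $\vee$-gate have the same set $\mathrm{vars}$. A circuit is an \emph{SDD respecting $T$} if it is a single constant, or a single literal on a variable of $T$, or if its output is an $\vee$-gate with children $g_1,\dots,g_\ell$, each $g_i$ an $\wedge$-gate with children $p_i,s_i$, and there is an inner node $v$ of $T$ with children $v_L,v_R$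 such that the subcircuits rooted at the $p_i$ are SDDs respecting $T_{v_L}$, those rooted at the $s_i$ are SDDs respecting $T_{v_R}$ (where $T_w$ is the subtree of $T$ rooted at $w$), and the functions computed at $p_1,\dots,p_\ell$ are satisfiable, pairwise disjoint, and have disjunction $\top$. For $x\in\{0,1\}^n$ let $\|x\|=x_1+\cdots+x_n$, and let $\mathrm{HWB}_n(x)=x_{\|x\|}$ if $\|x\|\ge 1$ and $\mathrm{HWB}_n(x)=0$ otherwise. For $n\ge 2$ let $\mathcal{T}_n$ be the set of vtrees $T$ for $\{x_1,\dots,x_n\}$ such that the left and right subtrees of the root of $T$ are right-linear (the left child of each of their inner nodes is a leaf) and the left one has $\lfloor 6n/10\rfloor$ leaves; the variables may be placed at the leaves in any order. \textbf{Proposition.} There are a polynomial $q$ and a constant $c>0$ such that for every $n\ge 2$ the set $\mathcal{T}_n$ is nonempty and, for every $T\in\mathcal{T}_n$: (a) $\mathrm{HWB}_n$ and $\overline{\mathrm{HWB}_n}$ can each be represented by a (smooth) structured d-DNNF w.r.t. $T$ of size at most $q(n)$; (b) there are SDDs respecting $T$ that represent $\mathrm{HWB}_n$, and each of them has size at least $c\cdot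 2^{n/5}$. -/

import Mathlib

/-- A full binary tree whose leaves carry labels in `X`. -/
inductive VTree (X : Type) : Type where
  | leaf (x : X) : VTree X
  | node (l r : VTree X) : VTree X

namespace VTree

variable {X : Type}

/-- The labels of the leaves, from left to right. -/
def leaves : VTree X → List X
  | leaf x => [x]
  | node l r => l.leaves ++ r.leaves

/-- The set of variables at the leaves. -/
def vars (T : VTree X) : Set X := {x | x ∈ T.leaves}

/-- `T` is a vtree for the variable set `X`: its leaves are in one-to-one correspondence with
the elements of `X`. -/
def IsVTree (T : VTree X) : Prop := T.leaves.Nodup ∧ ∀ x : X, x ∈ T.leaves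

/-- The subtrees of `T` rooted at the nodes of `T`. -/
def subtrees : VTree X → Set (VTree X)
  | leaf x => {leaf x}
  | node l r => insert (node l r) (l.subtrees ∪ r.subtrees)

/-- The left child of every inner node is a leaf. -/
def RightLinear : VTree X → Prop
  | leaf _ => True
  | node l r => (∃ x, l = leaf x) ∧ r.RightLinear

end VTree

/-- The label of a gate of a circuit in negation normal form, with variables in `X` and gates in
`V`: a constant, a literal (`lit x true` is `x` and `lit x false` is its negation), a conjunction
of fan-in two, or a disjunction of unbounded fan-in. -/
inductive NNFGate (X V : Type) : Type where
  | const (b : Bool) : NNFGate X V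
  | lit (x : X) (b : Bool) : NNFGate X V
  | and (l r : V) : NNFGate X V
  | or (cs : Finset V) : NNFGate X V

/-- The gates wired into a gate. -/
def NNFGate.children {X V : Type} : NNFGate X V → Set V
  | .const _ => ∅
  | .lit _ _ => ∅
  | .and l r => {l, r}
  | .or cs => {c | c ∈ cs}

/-- A circuit in negation normal form: a finite set of gates (input gates included) whose wires
form an acyclic graph (for finitely many gates: the child relation is well founded), and an
output gate. Gates may be shared. -/
structure NNFCircuit (X : Type) where
  V : Type
  finite : Finite V
  gate : V → NNFGate X V
  acyclic : WellFounded (fun u v : V => u ∈ (gate v).children)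
  out : V

namespace NNFCircuit

variable {X : Type}

/-- The size: the number of gates. -/
noncomputable def size (C : NNFCircuit X) : ℕ := Nat.card C.V

open Classical in
/-- The value computed at a gate, given the values computed at its children. -/
noncomputable def evalStep (a : X → Bool) {V : Type} (g : NNFGate X V)
    (val : (u : V) → u ∈ g.children → Bool) : Bool :=
  match g, val with
  | .const b, _ => b
  | .lit x b, _ => decide (a x = b)
  | .and l r, val => val l (Or.inl rfl) && val r (Or.inr rfl)
  | .or cs, val => decide (∃ (c : V) (h : c ∈ cs), val c h = true)

/-- The value computed at the gate `v` under the assignment `a`. -/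
noncomputable def eval (C : NNFCircuit X) (a : X → Bool) : C.V → Bool :=
  C.acyclic.fix fun v val => evalStep a (C.gate v) val

theorem eval_eq (C : NNFCircuit X) (a : X → Bool) (v : C.V) :
    C.eval a v = evalStep a (C.gate v) (fun u _ => C.eval a u) :=
  C.acyclic.fix_eq _ v

/-- The circuit represents the Boolean function `f`. -/
def Represents (C : NNFCircuit X) (f : (X → Bool) → Bool) : Prop :=
  ∀ a, C.eval a C.out = f a

/-- The variables for which a literal appears in the subcircuit rooted at `u`. -/
def vars (C : NNFCircuit X) (u : C.V) : Set X :=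
  {x | ∃ (w : C.V) (b : Bool),
    Relation.ReflTransGen (fun s t => t ∈ (C.gate s).children) u w ∧ C.gate w = .lit x b}

/-- The subcircuits leading into each conjunction have disjoint sets of variables. -/
def Decomposable (C : NNFCircuit X) : Prop :=
  ∀ u l r : C.V, C.gate u = .and l r → Disjoint (C.vars l) (C.vars r)

/-- Distinct children of a disjunction are never simultaneously satisfied. -/
def Deterministic (C : NNFCircuit X) : Prop :=
  ∀ (u : C.V) (cs : Finset C.V), C.gate u = .or cs →
    ∀ c ∈ cs, ∀ d ∈ cs, c ≠ d → ∀ a, ¬ (C.eval a c = true ∧ C.eval a d = true)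

/-- Every conjunction respects some inner node of the vtree. -/
def Respects (C : NNFCircuit X) (T : VTree X) : Prop :=
  ∀ u l r : C.V, C.gate u = .and l r →
    ∃ vl vr : VTree X, VTree.node vl vr ∈ T.subtrees ∧ C.vars l ⊆ vl.vars ∧ C.vars r ⊆ vr.vars

/-- The children of each disjunction mention the same variables. -/
def Smooth (C : NNFCircuit X) : Prop :=
  ∀ (u : C.V) (cs : Finset C.V), C.gate u = .or cs →
    ∀ c ∈ cs, ∀ d ∈ cs, C.vars c = C.vars d

/-- A structured d-DNNF with respect to the vtree `T`. -/
def IsStructuredDDNNF (C : NNFCircuit X) (T : VTree X) : Prop :=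
  C.Decomposable ∧ C.Deterministic ∧ C.Respects T

/-- A family of Boolean functions indexed by a finite set is a partition: no member is constantly
false, the members are pairwise disjoint, and their disjunction is constantly true. -/
def IsPartition {ι : Type} (s : Finset ι) (F : ι → (X → Bool) → Bool) : Prop :=
  (∀ i ∈ s, ∃ a, F i a = true) ∧
  (∀ i ∈ s, ∀ j ∈ s, i ≠ j → ∀ a, ¬ (F i a = true ∧ F j a = true)) ∧
  ∀ a, ∃ i ∈ s, F i a = true

/-- The subcircuit rooted at the given gate is a sentential decision diagram respecting the given
vtree. In a decomposition, the conjunction `g` has the prime `p g` as its left child and the sub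
`s g` as its right child. -/
inductive IsSDDAt (C : NNFCircuit X) : C.V → VTree X → Prop where
  | const (u : C.V) (T : VTree X) (b : Bool) (hu : C.gate u = .const b) : IsSDDAt C u T
  | lit (u : C.V) (T : VTree X) (x : X) (b : Bool) (hu : C.gate u = .lit x b)
      (hx : x ∈ T.vars) : IsSDDAt C u T
  | decomposition (u : C.V) (T vL vR : VTree X) (cs : Finset C.V) (p s : C.V → C.V)
      (hu : C.gate u = .or cs)
      (hv : VTree.node vL vR ∈ T.subtrees)
      (hg : ∀ g ∈ cs, C.gate g = .and (p g) (s g))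
      (hp : ∀ g ∈ cs, IsSDDAt C (p g) vL)
      (hs : ∀ g ∈ cs, IsSDDAt C (s g) vR)
      (hpart : IsPartition cs (fun g a => C.eval a (p g))) : IsSDDAt C u T

/-- The circuit is a sentential decision diagram respecting the vtree `T`. -/
def IsSDD (C : NNFCircuit X) (T : VTree X) : Prop := C.IsSDDAt C.out T

end NNFCircuit

/-- The number of variables set to one. -/
def hammingWeight {n : ℕ} (a : Fin n → Bool) : ℕ :=
  (Finset.univ.filter fun i => a i = true).card

/-- The hidden weighted bit function: the value of the variable `x_w`, where `w` is the number of
variables set to one and the variables are numbered from `1` to `n`, and `0` if `w = 0`.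
The element `i` of `Fin n` stands for the variable `x_(i+1)`. -/
def HWB (n : ℕ) (a : Fin n → Bool) : Bool :=
  decide (∃ i : Fin n, (i : ℕ) + 1 = hammingWeight a ∧ a i = true)

/-- The vtrees on `n` variables whose root has two right-linear subtrees, the left one with
`⌊6n/10⌋` leaves and the right one with the remaining leaves. The variables are placed at the
leaves in any order. -/
def IsHWBVTree (n : ℕ) (T : VTree (Fin n)) : Prop :=
  T.IsVTree ∧ ∃ L R : VTree (Fin n), T = .node L R ∧ L.RightLinear ∧ R.RightLinear ∧
    L.leaves.length = 6 * n / 10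

/-! A d-DNNF may guess the weight of the input at the root, because a verified guess is unique. The
primes of an SDD see only the left variables and must partition their assignments.

Upper bound. The condition "weight j below t, and variable number k has value b if it occurs below
t" splits at an inner node into the cases j₁ + j₂ = j. With the guess that k is the total weight,
these quadratically many states per node (`hwbRule`) evaluate `HWB n a = b`, and `StateRule.circuit`
turns them into a circuit. It is deterministic because the assignment fixes j₁ and j₂, hence also k
at the root. Dropping unsatisfiable pairs makes it smooth.

Existence of SDDs is Shannon expansion over the left variables at every inner node.

Lower bound. In a decomposition at the root, each left assignment satisfies exactly one prime, whose
sub is the cofactor. So the size is at least the number of left cofactors (`IsSDD.card_le_size`).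
Let Y be the set of left variables and r ≈ 2n/5 the number of right ones. One of two adjacent
windows of r + 1 indices contains about r/2 ≈ n/5 elements of Y, which form Z
(`exists_subset_window`). Pad a pattern on Z inside Y to the weight v at which the window starts.
Switching on up to r right variables then makes the weight point at any chosen index of Z, so the
cofactor reveals the pattern. Of a pattern and its complement in Z at least one can be padded, so
half of all patterns survive (`exists_patterns`). -/

/-! ### Vtrees and their subtrees -/

namespace VTree

variable {X : Type}

theorem self_mem_subtrees (T : VTree X) : T ∈ T.subtrees := by
  cases T <;> simp [subtrees]

theorem subtrees_trans {S T U : VTree X} (hST : S ∈ T.subtrees) (hTU : T ∈ U.subtrees) :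
    S ∈ U.subtrees := by
  induction U with
  | leaf x =>
    obtain rfl : T = leaf x := by simpa [subtrees] using hTU
    exact hST
  | node l r ihl ihr =>
    simp only [subtrees, Set.mem_insert_iff, Set.mem_union] at hTU
    rcases hTU with rfl | h | h
    · exact hST
    · exact Or.inr (Or.inl (ihl h))
    · exact Or.inr (Or.inr (ihr h))

theorem left_mem_subtrees {l r T : VTree X} (h : node l r ∈ T.subtrees) : l ∈ T.subtrees :=
  subtrees_trans (T := node l r) (Or.inr (Or.inl l.self_mem_subtrees)) h

theorem right_mem_subtrees {l r T : VTree X} (h : node l r ∈ T.subtrees) : r ∈ T.subtrees :=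
  subtrees_trans (T := node l r) (Or.inr (Or.inr r.self_mem_subtrees)) h

theorem vars_node (l r : VTree X) : (node l r).vars = l.vars ∪ r.vars := by
  ext x; simp [vars, leaves]

theorem vars_leaf (x : X) : (leaf x).vars = {x} := by
  ext y; simp [vars, leaves]

theorem leaves_sublist {S T : VTree X} (h : S ∈ T.subtrees) : S.leaves.Sublist T.leaves := by
  induction T with
  | leaf x =>
    obtain rfl : S = leaf x := by simpa [subtrees] using h
    exact List.Sublist.refl _
  | node l r ihl ihr =>
    simp only [subtrees, Set.mem_insert_iff, Set.mem_union] at h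
    rcases h with rfl | h | h
    · exact List.Sublist.refl _
    · exact (ihl h).trans (List.sublist_append_left _ _)
    · exact (ihr h).trans (List.sublist_append_right _ _)

theorem vars_subset_of_mem_subtrees {S T : VTree X} (h : S ∈ T.subtrees) : S.vars ⊆ T.vars :=
  fun _ hx => (leaves_sublist h).subset hx

theorem leaves_length_pos (T : VTree X) : 0 < T.leaves.length := by
  induction T <;> simp_all [leaves]

theorem subtrees_finite (T : VTree X) : T.subtrees.Finite := by
  induction T with
  | leaf x => exact Set.finite_singleton _
  | node l r ihl ihr => exact (ihl.union ihr).insert _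

theorem ncard_subtrees_le (T : VTree X) : T.subtrees.ncard + 1 ≤ 2 * T.leaves.length := by
  induction T with
  | leaf x => simp [subtrees, leaves]
  | node l r ihl ihr =>
    have h1 := Set.ncard_insert_le (node l r) (l.subtrees ∪ r.subtrees)
    have h2 := Set.ncard_union_le l.subtrees r.subtrees
    simp only [subtrees, leaves, List.length_append]
    omega

theorem disjoint_vars_of_mem_subtrees {l r T : VTree X} (hT : T.leaves.Nodup)
    (h : node l r ∈ T.subtrees) : Disjoint l.vars r.vars := by
  have h1 : (l.leaves ++ r.leaves).Nodup := hT.sublist (leaves_sublist h)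
  rw [Set.disjoint_left]
  exact fun x hx hx' => (List.nodup_append'.1 h1).2.2 hx hx'

end VTree

/-! ### Values and variables of gates -/

namespace NNFCircuit

variable {X : Type}

section Unfolding

variable (C : NNFCircuit X) {u : C.V}

theorem eval_const {b : Bool} (h : C.gate u = .const b) (a : X → Bool) : C.eval a u = b := by
  rw [eval_eq]; generalize C.gate u = g at h; subst h; rfl

theorem eval_lit {x : X} {b : Bool} (h : C.gate u = .lit x b) (a : X → Bool) :
    C.eval a u = decide (a x = b) := by
  rw [eval_eq]; generalize C.gate u = g at h; subst h; simp [evalStep]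

theorem eval_and {l r : C.V} (h : C.gate u = .and l r) (a : X → Bool) :
    C.eval a u = (C.eval a l && C.eval a r) := by
  rw [eval_eq]; generalize C.gate u = g at h; subst h; rfl

theorem eval_or {cs : Finset C.V} (h : C.gate u = .or cs) (a : X → Bool) :
    C.eval a u = true ↔ ∃ c ∈ cs, C.eval a c = true := by
  rw [eval_eq]; generalize C.gate u = g at h; subst h; simp [evalStep]

theorem mem_vars_iff {x : X} :
    x ∈ C.vars u ↔ (∃ b, C.gate u = .lit x b) ∨ ∃ c ∈ (C.gate u).children, x ∈ C.vars c := by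
  constructor
  · rintro ⟨w, b, hw, hx⟩
    rcases Relation.ReflTransGen.cases_head hw with rfl | ⟨c, hc, hcw⟩
    · exact Or.inl ⟨b, hx⟩
    · exact Or.inr ⟨c, hc, w, b, hcw, hx⟩
  · rintro (⟨b, hb⟩ | ⟨c, hc, w, b, hw, hx⟩)
    · exact ⟨u, b, .refl, hb⟩
    · exact ⟨w, b, .head hc hw, hx⟩

theorem vars_const {b : Bool} (h : C.gate u = .const b) : C.vars u = ∅ := by
  ext x; rw [mem_vars_iff, h]; simp [NNFGate.children]

theorem vars_lit {x : X} {b : Bool} (h : C.gate u = .lit x b) : C.vars u = {x} := by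
  ext y; rw [mem_vars_iff, h]; simp [NNFGate.children, eq_comm]

theorem vars_and {l r : C.V} (h : C.gate u = .and l r) : C.vars u = C.vars l ∪ C.vars r := by
  ext x; rw [mem_vars_iff, h]; simp [NNFGate.children]

theorem mem_vars_or {cs : Finset C.V} (h : C.gate u = .or cs) {x : X} :
    x ∈ C.vars u ↔ ∃ c ∈ cs, x ∈ C.vars c := by
  rw [mem_vars_iff, h]; simp [NNFGate.children]

end Unfolding

/-! ### Circuits from dynamic programs along a vtree -/

/-- A rule for evaluating finitely many states along a vtree: a state at a leaf is a constant or a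
literal, and a state at an inner node is a disjunction of pairs of states of the children. -/
structure StateRule (X Q : Type) where
  leaf : X → Q → Bool ⊕ Bool
  node : VTree X → VTree X → Q → Finset (Q × Q)

namespace StateRule

variable {Q : Type} (R : StateRule X Q)

/-- The Boolean function of a state at a vtree. -/
def Holds (R : StateRule X Q) (a : X → Bool) : VTree X → Q → Prop
  | .leaf x, q => Sum.elim (fun b => b = true) (fun b => a x = b) (R.leaf x q)
  | .node l r, q => ∃ p ∈ R.node l r q, Holds R a l p.1 ∧ Holds R a r p.2

/-- The gates of the circuit that evaluates a rule along `T`: at each subtree, one for each state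
and one for each pair of states. -/
abbrev Gates (T : VTree X) (Q : Type) : Type := {t // t ∈ T.subtrees} × (Q ⊕ Q × Q)

/-- The gate for a state, or the conjunction for a pair of states. -/
def gate (T : VTree X) : Gates T Q → NNFGate X (Gates T Q)
  | (⟨.leaf x, _⟩, .inl q) =>
    match R.leaf x q with
    | .inl b => .const b
    | .inr b => .lit x b
  | (⟨.leaf _, _⟩, .inr _) => .const false
  | (⟨.node l r, h⟩, .inl q) => .or ((R.node l r q).map
      ⟨fun p => (⟨.node l r, h⟩, .inr p), fun p p' hp => by simpa using hp⟩)
  | (⟨.node l r, h⟩, .inr p) => .and (⟨l, VTree.left_mem_subtrees h⟩, .inl p.1)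
      (⟨r, VTree.right_mem_subtrees h⟩, .inl p.2)

/-- A rank that decreases along the wires. -/
def rank {T : VTree X} (u : Gates T Q) : ℕ :=
  -- The summand puts a state above the pairs at the same subtree; the doubling pays for it on the
  -- way to a child.
  2 * u.1.1.leaves.length + Sum.elim (fun _ => 1) (fun _ => 0) u.2

theorem rank_lt {T : VTree X} (u v : Gates T Q) (h : u ∈ (R.gate T v).children) :
    rank u < rank v := by
  match v with
  | (⟨.leaf x, _⟩, .inl q) =>
    dsimp only [gate] at h
    generalize R.leaf x q = g at h
    cases g <;> exact False.elim h
  | (⟨.leaf _, _⟩, .inr _) => exact h.elim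
  | (⟨.node l r, h'⟩, .inl q) =>
    obtain ⟨p, -, rfl⟩ := Finset.mem_map.1 h
    exact Nat.lt_succ_self _
  | (⟨.node l r, h'⟩, .inr p) =>
    have hl := l.leaves_length_pos
    have hr := r.leaves_length_pos
    rcases h with rfl | rfl <;> simp [rank, VTree.leaves] <;> omega

/-- The circuit that evaluates the state `q` along the vtree `T`. -/
def circuit [Finite Q] (T : VTree X) (q : Q) : NNFCircuit X where
  V := Gates T Q
  finite := by
    have := T.subtrees_finite.to_subtype
    infer_instance
  gate := R.gate T
  acyclic := Subrelation.wf (fun {u v} h => R.rank_lt u v h) (measure rank).wf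
  out := (⟨T, T.self_mem_subtrees⟩, .inl q)

variable [Finite Q] {T : VTree X} {q₀ : Q}

theorem size_circuit_le :
    (R.circuit T q₀).size ≤ 2 * T.leaves.length * (Nat.card Q + Nat.card Q ^ 2) := by
  have := T.subtrees_finite.to_subtype
  have h1 : (R.circuit T q₀).size = T.subtrees.ncard * (Nat.card Q + Nat.card Q ^ 2) := by
    change Nat.card (Gates T Q) = _
    rw [Nat.card_prod, Nat.card_sum, Nat.card_prod, sq]
    rfl
  rw [h1]
  exact Nat.mul_le_mul_right _ (by have := T.ncard_subtrees_le; omega)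

/-- The gate of a state at a subtree. -/
def stateGate (T : VTree X) (q₀ : Q) (t : VTree X) (h : t ∈ T.subtrees) (q : Q) :
    (R.circuit T q₀).V := (⟨t, h⟩, .inl q)

/-- The gate of a pair of states at a subtree. -/
def pairGate (T : VTree X) (q₀ : Q) (t : VTree X) (h : t ∈ T.subtrees) :
    Q × Q ↪ (R.circuit T q₀).V :=
  ⟨fun p => (⟨t, h⟩, .inr p), fun _ _ hp => Sum.inr.inj (Prod.mk.inj hp).2⟩

theorem gate_leaf_const {x : X} {q : Q} {b : Bool} (hq : R.leaf x q = .inl b)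
    (h : VTree.leaf x ∈ T.subtrees) :
    (R.circuit T q₀).gate (R.stateGate T q₀ (.leaf x) h q) = .const b := by
  change R.gate T (⟨.leaf x, h⟩, .inl q) = _
  simp only [gate, hq]
  rfl

theorem gate_leaf_lit {x : X} {q : Q} {b : Bool} (hq : R.leaf x q = .inr b)
    (h : VTree.leaf x ∈ T.subtrees) :
    (R.circuit T q₀).gate (R.stateGate T q₀ (.leaf x) h q) = .lit x b := by
  change R.gate T (⟨.leaf x, h⟩, .inl q) = _
  simp only [gate, hq]
  rfl

theorem gate_node {l r : VTree X} {q : Q} (h : VTree.node l r ∈ T.subtrees) :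
    (R.circuit T q₀).gate (R.stateGate T q₀ (.node l r) h q) =
      .or ((R.node l r q).map (R.pairGate T q₀ (.node l r) h)) := rfl

theorem gate_pair {l r : VTree X} {p : Q × Q} (h : VTree.node l r ∈ T.subtrees) :
    (R.circuit T q₀).gate (R.pairGate T q₀ (.node l r) h p) =
      .and (R.stateGate T q₀ l (VTree.left_mem_subtrees h) p.1)
        (R.stateGate T q₀ r (VTree.right_mem_subtrees h) p.2) := rfl

theorem eval_circuit (a : X → Bool) (t : VTree X) (h : t ∈ T.subtrees) (q : Q) :
    (R.circuit T q₀).eval a (R.stateGate T q₀ t h q) = true ↔ R.Holds a t q := by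
  induction t generalizing q with
  | leaf x =>
    cases hg : R.leaf x q with
    | inl b => rw [eval_const _ (R.gate_leaf_const hg h)]; simp [Holds, hg]
    | inr b => rw [eval_lit _ (R.gate_leaf_lit hg h)]; simp [Holds, hg]
  | node l r ihl ihr =>
    rw [eval_or _ (R.gate_node h)]
    simp only [Finset.mem_map, exists_exists_and_eq_and, eval_and _ (R.gate_pair h),
      Bool.and_eq_true, ihl, ihr, Holds]

theorem vars_circuit_subset (t : VTree X) (h : t ∈ T.subtrees) (q : Q) :
    (R.circuit T q₀).vars (R.stateGate T q₀ t h q) ⊆ t.vars := by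
  induction t generalizing q with
  | leaf x =>
    cases hg : R.leaf x q with
    | inl b => rw [vars_const _ (R.gate_leaf_const hg h)]; exact Set.empty_subset _
    | inr b => rw [vars_lit _ (R.gate_leaf_lit hg h), VTree.vars_leaf]
  | node l r ihl ihr =>
    intro x hx
    rw [mem_vars_or _ (R.gate_node h)] at hx
    obtain ⟨c, hc, hx⟩ := hx
    obtain ⟨p, hp, rfl⟩ := Finset.mem_map.1 hc
    rw [vars_and _ (R.gate_pair h)] at hx
    rw [VTree.vars_node]
    exact hx.imp (fun h => ihl _ _ h) (fun h => ihr _ _ h)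

theorem gate_eq_and {u l r : (R.circuit T q₀).V} (h : (R.circuit T q₀).gate u = .and l r) :
    ∃ (vl vr : VTree X) (hv : VTree.node vl vr ∈ T.subtrees) (p : Q × Q),
      l = R.stateGate T q₀ vl (VTree.left_mem_subtrees hv) p.1 ∧
        r = R.stateGate T q₀ vr (VTree.right_mem_subtrees hv) p.2 := by
  match u with
  | (⟨.leaf x, hx⟩, .inl q) =>
    cases hg : R.leaf x q with
    | inl b => exact NNFGate.noConfusion rfl rfl (heq_of_eq ((R.gate_leaf_const hg hx).symm.trans h))
    | inr b => exact NNFGate.noConfusion rfl rfl (heq_of_eq ((R.gate_leaf_lit hg hx).symm.trans h))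
  | (⟨.leaf _, _⟩, .inr _) => cases h
  | (⟨.node vl vr, hv⟩, .inl q) => cases h
  | (⟨.node vl vr, hv⟩, .inr p) => cases h; exact ⟨vl, vr, hv, p, rfl, rfl⟩

theorem gate_eq_or {u : (R.circuit T q₀).V} {cs : Finset (R.circuit T q₀).V}
    (h : (R.circuit T q₀).gate u = .or cs) :
    ∃ (vl vr : VTree X) (hv : VTree.node vl vr ∈ T.subtrees) (q : Q),
      cs = (R.node vl vr q).map (R.pairGate T q₀ (.node vl vr) hv) := by
  match u with
  | (⟨.leaf x, hx⟩, .inl q) =>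
    cases hg : R.leaf x q with
    | inl b => exact NNFGate.noConfusion rfl rfl (heq_of_eq ((R.gate_leaf_const hg hx).symm.trans h))
    | inr b => exact NNFGate.noConfusion rfl rfl (heq_of_eq ((R.gate_leaf_lit hg hx).symm.trans h))
  | (⟨.leaf _, _⟩, .inr _) => cases h
  | (⟨.node vl vr, hv⟩, .inl q) => cases h; exact ⟨vl, vr, hv, q, rfl⟩
  | (⟨.node vl vr, hv⟩, .inr p) => cases h

/-- The alternatives of each state are mutually exclusive. -/
def Exclusive (T : VTree X) : Prop :=
  ∀ l r, VTree.node l r ∈ T.subtrees → ∀ q, ∀ p ∈ R.node l r q, ∀ p' ∈ R.node l r q, p ≠ p' →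
    ∀ a, R.Holds a l p.1 → R.Holds a r p.2 → R.Holds a l p'.1 → R.Holds a r p'.2 → False

/-- A gate mentions only variables below its own subtree, which gives decomposability and respect
for `T`; determinism is exclusivity of the alternatives. -/
theorem isStructuredDDNNF_circuit (hT : T.leaves.Nodup) (hR : R.Exclusive T) :
    (R.circuit T q₀).IsStructuredDDNNF T := by
  refine ⟨?_, ?_, ?_⟩
  · intro u l r h
    obtain ⟨vl, vr, hv, p, rfl, rfl⟩ := R.gate_eq_and h
    exact (VTree.disjoint_vars_of_mem_subtrees hT hv).mono (R.vars_circuit_subset _ _ _)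
      (R.vars_circuit_subset _ _ _)
  · intro u cs h c hc d hd hcd a ⟨h1, h2⟩
    obtain ⟨vl, vr, hv, q, rfl⟩ := R.gate_eq_or h
    obtain ⟨p, hp, rfl⟩ := Finset.mem_map.1 hc
    obtain ⟨p', hp', rfl⟩ := Finset.mem_map.1 hd
    rw [eval_and _ (R.gate_pair hv), Bool.and_eq_true, eval_circuit, eval_circuit] at h1 h2
    exact hR vl vr hv q p hp p' hp' (fun e => hcd (by rw [e])) a h1.1 h1.2 h2.1 h2.2
  · intro u l r h
    obtain ⟨vl, vr, hv, p, rfl, rfl⟩ := R.gate_eq_and h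
    exact ⟨vl, vr, hv, R.vars_circuit_subset _ _ _, R.vars_circuit_subset _ _ _⟩

/-- Only the constant `⊥` is used at the leaves, and all alternatives are satisfiable. -/
def Trim (R : StateRule X Q) : Prop :=
  (∀ x q, R.leaf x q ≠ .inl true) ∧
    ∀ l r q, ∀ p ∈ R.node l r q, (∃ a, R.Holds a l p.1) ∧ ∃ a, R.Holds a r p.2

-- A satisfiable state at an inner node has an alternative, whose two states are again satisfiable.
-- Descending this way reaches a literal at every leaf: satisfiability excludes ⊥ there and trimness
-- excludes ⊤.
variable {R} in
theorem Trim.vars_circuit (hR : R.Trim) (t : VTree X) (h : t ∈ T.subtrees) (q : Q)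
    (hq : ∃ a, R.Holds a t q) : (R.circuit T q₀).vars (R.stateGate T q₀ t h q) = t.vars := by
  induction t generalizing q with
  | leaf x =>
    obtain ⟨a, ha⟩ := hq
    cases hg : R.leaf x q with
    | inl b =>
      simp only [Holds, hg, Sum.elim_inl] at ha
      exact absurd (ha ▸ hg) (hR.1 x q)
    | inr b => rw [vars_lit _ (R.gate_leaf_lit hg h), VTree.vars_leaf]
  | node l r ihl ihr =>
    refine (R.vars_circuit_subset _ _ _).antisymm fun x hx => ?_
    obtain ⟨a, p, hp, -⟩ := hq
    rw [mem_vars_or _ (R.gate_node h)]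
    refine ⟨_, Finset.mem_map_of_mem _ hp, ?_⟩
    rw [vars_and _ (R.gate_pair h), ihl _ _ (hR.2 l r q p hp).1, ihr _ _ (hR.2 l r q p hp).2,
      ← VTree.vars_node]
    exact hx

variable {R} in
theorem Trim.smooth_circuit (hR : R.Trim) : (R.circuit T q₀).Smooth := by
  intro u cs h
  obtain ⟨vl, vr, hv, q, rfl⟩ := R.gate_eq_or h
  have key : ∀ c ∈ (R.node vl vr q).map (R.pairGate T q₀ (.node vl vr) hv),
      (R.circuit T q₀).vars c = vl.vars ∪ vr.vars := by
    intro c hc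
    obtain ⟨p, hp, rfl⟩ := Finset.mem_map.1 hc
    rw [vars_and _ (R.gate_pair hv), hR.vars_circuit _ _ _ (hR.2 _ _ q p hp).1,
      hR.vars_circuit _ _ _ (hR.2 _ _ q p hp).2]
  exact fun c hc d hd => (key c hc).trans (key d hd).symm

end StateRule

end NNFCircuit

/-! ### Sentential decision diagrams: existence and the cofactor bound -/

namespace NNFCircuit

variable {X : Type}

section ExistsSDD

/-- The conjunction of the literals at the leaves of `t` that `a` satisfies. -/
def minterm (t : VTree X) (a : X → Bool) : (X → Bool) → Bool :=
  fun x => decide (∀ i ∈ t.leaves, x i = a i)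

theorem dependsOn_minterm (t : VTree X) (a : X → Bool) : DependsOn (minterm t a) t.vars := by
  intro x y h
  simp only [minterm, decide_eq_decide]
  exact forall₂_congr fun i hi => by rw [h i hi]

variable [DecidableEq X]

/-- The function obtained from `f` by assigning the values of `a` to the variables of `t`. -/
def cofactor (t : VTree X) (a : X → Bool) (f : (X → Bool) → Bool) : (X → Bool) → Bool :=
  fun x => f (fun i => if i ∈ t.leaves then a i else x i)

theorem dependsOn_cofactor {l r : VTree X} {f : (X → Bool) → Bool}
    (hf : DependsOn f (VTree.node l r).vars) (a : X → Bool) :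
    DependsOn (cofactor l a f) r.vars := by
  intro x y h
  refine hf fun i hi => ?_
  rw [VTree.vars_node] at hi
  by_cases hl : i ∈ l.leaves
  · simp [hl]
  · simpa [hl] using h i (hi.resolve_left hl)

variable [Fintype X]

variable (X) in
/-- The Shannon expansion over all assignments to the left variables, at every inner node. -/
def shannonRule : StateRule X ((X → Bool) → Bool) where
  -- A function of the variable at the leaf is determined by its values at the two constant
  -- assignments.
  leaf _ f := if f (fun _ => true) = f (fun _ => false) then .inl (f fun _ => true)
    else .inr (f fun _ => true)
  node l _ f := Finset.univ.image fun a => (minterm l a, cofactor l a f)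

theorem holds_shannonRule (a : X → Bool) (t : VTree X) (f : (X → Bool) → Bool)
    (hf : DependsOn f t.vars) : (shannonRule X).Holds a t f ↔ f a = true := by
  induction t generalizing f with
  | leaf x =>
    have h : f a = f (fun _ => a x) := hf fun i hi => by
      rw [VTree.vars_leaf] at hi; rw [Set.mem_singleton_iff.1 hi]
    rw [h]
    simp only [StateRule.Holds, shannonRule]
    rcases h0 : f (fun _ => true) <;> rcases h1 : f (fun _ => false) <;> cases h2 : a x <;>
      simp [h0, h1]
  | node l r ihl ihr =>
    -- If `a` satisfies the minterm of `b`, then substituting `b` on the left changes nothing.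
    have key : ∀ b, minterm l b a = true → cofactor l b f a = f a := by
      intro b hb
      simp only [minterm, decide_eq_true_eq] at hb
      refine congrArg f (funext fun i => ?_)
      by_cases hi : i ∈ l.leaves <;> simp [hi, hb]
    simp only [StateRule.Holds, shannonRule, Finset.mem_image, Finset.mem_univ, true_and,
      exists_exists_eq_and]
    constructor
    · rintro ⟨b, h1, h2⟩
      rw [← shannonRule, ihl _ (dependsOn_minterm l b)] at h1
      rw [← shannonRule, ihr _ (dependsOn_cofactor hf b)] at h2
      rw [← key b h1, h2]
    · intro h
      have h1 : minterm l a a = true := by simp [minterm]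
      refine ⟨a, (ihl _ (dependsOn_minterm l a)).2 h1, (ihr _ (dependsOn_cofactor hf a)).2 ?_⟩
      rw [key a h1, h]

theorem isSDDAt_shannonRule {T : VTree X} {q₀ : (X → Bool) → Bool} (t : VTree X)
    (h : t ∈ T.subtrees) (f : (X → Bool) → Bool) (hf : DependsOn f t.vars) :
    ((shannonRule X).circuit T q₀).IsSDDAt ((shannonRule X).stateGate T q₀ t h f) t := by
  induction t generalizing f with
  | leaf x =>
    cases hg : (shannonRule X).leaf x f with
    | inl b => exact .const _ _ b (StateRule.gate_leaf_const _ hg h)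
    | inr b => exact .lit _ _ x b (StateRule.gate_leaf_lit _ hg h) (by simp [VTree.vars_leaf])
  | node l r ihl ihr =>
    have hl := VTree.left_mem_subtrees h
    have hr := VTree.right_mem_subtrees h
    refine .decomposition _ _ l r _
      -- Only pair gates matter here; the value `g` on state gates is a dummy.
      (fun g : StateRule.Gates T _ => Sum.elim (fun _ => g)
        (fun p => (shannonRule X).stateGate T q₀ l hl p.1) g.2)
      (fun g : StateRule.Gates T _ => Sum.elim (fun _ => g)
        (fun p => (shannonRule X).stateGate T q₀ r hr p.2) g.2)
      (StateRule.gate_node _ h) (VTree.self_mem_subtrees _) ?_ ?_ ?_ ⟨?_, ?_, ?_⟩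
    · intro g hg
      obtain ⟨p, hp, rfl⟩ := Finset.mem_map.1 hg
      rfl
    · intro g hg
      obtain ⟨p, hp, rfl⟩ := Finset.mem_map.1 hg
      obtain ⟨a, -, rfl⟩ := Finset.mem_image.1 hp
      exact ihl hl _ (dependsOn_minterm l a)
    · intro g hg
      obtain ⟨p, hp, rfl⟩ := Finset.mem_map.1 hg
      obtain ⟨a, -, rfl⟩ := Finset.mem_image.1 hp
      exact ihr hr _ (dependsOn_cofactor hf a)
    · intro g hg
      obtain ⟨p, hp, rfl⟩ := Finset.mem_map.1 hg
      obtain ⟨a, -, rfl⟩ := Finset.mem_image.1 hp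
      refine ⟨a, (StateRule.eval_circuit _ a l hl _).2
        ((holds_shannonRule a l _ (dependsOn_minterm l a)).2 ?_)⟩
      simp [minterm]
    · intro g hg g' hg' hne x ⟨h1, h2⟩
      obtain ⟨p, hp, rfl⟩ := Finset.mem_map.1 hg
      obtain ⟨a, -, rfl⟩ := Finset.mem_image.1 hp
      obtain ⟨p, hp, rfl⟩ := Finset.mem_map.1 hg'
      obtain ⟨b, -, rfl⟩ := Finset.mem_image.1 hp
      have h1' := (holds_shannonRule x l _ (dependsOn_minterm l a)).1
        ((StateRule.eval_circuit _ x l hl _).1 h1)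
      have h2' := (holds_shannonRule x l _ (dependsOn_minterm l b)).1
        ((StateRule.eval_circuit _ x l hl _).1 h2)
      simp only [minterm, decide_eq_true_eq] at h1' h2'
      -- Two assignments with a common point in their minterms agree on the left, so they yield the
      -- same pair and the same gate.
      have hab : ∀ i ∈ l.leaves, a i = b i := fun i hi => (h1' i hi).symm.trans (h2' i hi)
      refine hne (congrArg _ (Prod.ext (funext fun y => ?_) (funext fun y => ?_)))
      · simp only [minterm, decide_eq_decide]
        exact forall₂_congr fun i hi => by rw [hab i hi]
      · refine congrArg f (funext fun i => ?_)
        by_cases hi : i ∈ l.leaves <;> simp [hi, hab]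
    · intro a
      refine ⟨_, Finset.mem_map_of_mem _ (Finset.mem_image_of_mem _ (Finset.mem_univ a)),
        (StateRule.eval_circuit _ a l hl _).2
          ((holds_shannonRule a l _ (dependsOn_minterm l a)).2 ?_)⟩
      simp [minterm]

/-- Every function of the variables of a vtree has a sentential decision diagram. -/
theorem exists_isSDD (T : VTree X) (f : (X → Bool) → Bool) (hf : DependsOn f T.vars) :
    ∃ S : NNFCircuit X, S.IsSDD T ∧ S.Represents f := by
  refine ⟨(shannonRule X).circuit T f, isSDDAt_shannonRule T T.self_mem_subtrees f hf, fun a => ?_⟩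
  rw [Bool.eq_iff_iff]
  exact ((shannonRule X).eval_circuit a T T.self_mem_subtrees f).trans (holds_shannonRule a T f hf)

end ExistsSDD

theorem IsSDDAt.dependsOn {C : NNFCircuit X} {u : C.V} {T : VTree X} (h : C.IsSDDAt u T) :
    DependsOn (fun a => C.eval a u) T.vars := by
  induction h with
  | const u T b hu => intro a a' _; simp only [C.eval_const hu]
  | lit u T x b hu hx => intro a a' h; simp only [C.eval_lit hu, h x hx]
  | decomposition u T vL vR cs p s hu hv hg hp hs hpart ihp ihs =>
    intro a a' h
    have h' := fun i hi => h i (VTree.vars_subset_of_mem_subtrees hv hi)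
    rw [VTree.vars_node] at h'
    change C.eval a u = C.eval a' u
    rw [Bool.eq_iff_iff, C.eval_or hu, C.eval_or hu]
    refine exists_congr fun g => and_congr_right fun hgc => ?_
    have h1 : C.eval a (p g) = C.eval a' (p g) := ihp g hgc fun i hi => h' i (Or.inl hi)
    have h2 : C.eval a (s g) = C.eval a' (s g) := ihs g hgc fun i hi => h' i (Or.inr hi)
    rw [C.eval_and (hg g hgc), C.eval_and (hg g hgc), h1, h2]

open Classical in
/-- A sentential decision diagram for a function that depends on variables of both subtrees of the
root has at least as many gates as the function has cofactors by assignments to the variables of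
the left subtree. -/
theorem IsSDD.card_le_size {C : NNFCircuit X} {L R : VTree X} (hC : C.IsSDD (.node L R))
    (hLR : Disjoint L.vars R.vars) {f : (X → Bool) → Bool} (hf : C.Represents f)
    (hL : ¬ DependsOn f L.vars) (hR : ¬ DependsOn f R.vars) {ι : Type} (G : Finset ι)
    (a : ι → X → Bool) (ha : ∀ i ∈ G, ∀ j ∈ G, i ≠ j →
      ∃ b, f (L.vars.piecewise (a i) b) ≠ f (L.vars.piecewise (a j) b)) :
    G.card ≤ C.size := by
  have hfC : (fun a => C.eval a C.out) = f := funext hf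
  -- An SDD may also be a constant, a literal, or a decomposition at a node below the root. In all
  -- these cases the function would depend on one side only.
  have hsub : ∀ S : VTree X, C.IsSDDAt C.out S → S.vars ⊆ L.vars ∨ S.vars ⊆ R.vars → False := by
    intro S hS h
    have h' := hS.dependsOn
    rw [hfC] at h'
    rcases h with h | h
    · exact hL fun x y hxy => h' fun i hi => hxy i (h hi)
    · exact hR fun x y hxy => h' fun i hi => hxy i (h hi)
  have := C.finite
  cases hC with
  | const _ _ b hu => exact (hsub L (.const _ _ b hu) (Or.inl subset_rfl)).elim
  | lit _ _ x b hu hx =>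
    rw [VTree.vars_node] at hx
    rcases hx with hx | hx
    · exact (hsub L (.lit _ _ x b hu hx) (Or.inl subset_rfl)).elim
    · exact (hsub R (.lit _ _ x b hu hx) (Or.inr subset_rfl)).elim
  | decomposition _ _ vL vR cs p s hu hv hg hp hs hpart =>
    simp only [VTree.subtrees, Set.mem_insert_iff, Set.mem_union] at hv
    rcases hv with hv | hv | hv
    · cases hv
      choose g hgc hgt using fun i => hpart.2.2 (a i)
      -- The prime of `g i` is the only one that `a i` satisfies, so the cofactor of `f` by `a i` is
      -- the sub of `g i`.
      have key : ∀ i b, f (L.vars.piecewise (a i) b) = C.eval b (s (g i)) := by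
        intro i b
        have hpi : ∀ c ∈ cs, C.eval (L.vars.piecewise (a i) b) (p c) = C.eval (a i) (p c) :=
          fun c hc => (hp c hc).dependsOn fun k hk => Set.piecewise_eq_of_mem _ _ _ hk
        have hsi : ∀ c ∈ cs, C.eval (L.vars.piecewise (a i) b) (s c) = C.eval b (s c) :=
          fun c hc => (hs c hc).dependsOn fun k hk =>
            Set.piecewise_eq_of_notMem _ _ _ (Set.disjoint_right.1 hLR hk)
        rw [← hf, Bool.eq_iff_iff, C.eval_or hu]
        constructor
        · rintro ⟨c, hc, h⟩
          rw [C.eval_and (hg c hc), Bool.and_eq_true, hpi c hc, hsi c hc] at h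
          have : c = g i := by
            by_contra hne
            exact hpart.2.1 c hc (g i) (hgc i) hne (a i) ⟨h.1, hgt i⟩
          exact this ▸ h.2
        · intro h
          refine ⟨g i, hgc i, ?_⟩
          rw [C.eval_and (hg _ (hgc i)), Bool.and_eq_true, hpi _ (hgc i), hsi _ (hgc i)]
          exact ⟨hgt i, h⟩
      have hinj : Set.InjOn g G := by
        intro i hi j hj hij
        by_contra hne
        obtain ⟨b, hb⟩ := ha i hi j hj hne
        exact hb (by rw [key, key, hij])
      calc G.card = (G.image g).card := (Finset.card_image_of_injOn hinj).symm
        _ ≤ Nat.card C.V := by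
          have := Fintype.ofFinite C.V
          rw [Nat.card_eq_fintype_card]
          exact Finset.card_le_univ _
    · exact (hsub L (.decomposition _ _ vL vR cs p s hu hv hg hp hs hpart)
        (Or.inl subset_rfl)).elim
    · exact (hsub R (.decomposition _ _ vL vR cs p s hu hv hg hp hs hpart)
        (Or.inr subset_rfl)).elim

end NNFCircuit

/-! ### Polynomial-size d-DNNFs for the hidden weighted bit function -/

namespace VTree

theorem IsVTree.countP_leaves {n : ℕ} {T : VTree (Fin n)} (hT : T.IsVTree) (a : Fin n → Bool) :
    T.leaves.countP a = hammingWeight a := by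
  rw [hammingWeight, List.countP_eq_length_filter,
    ← List.toFinset_card_of_nodup (hT.1.filter a)]
  congr 1
  ext i
  simp [hT.2 i]

theorem IsVTree.length_leaves {n : ℕ} {T : VTree (Fin n)} (hT : T.IsVTree) :
    T.leaves.length = n := by
  have h : T.leaves.toFinset = Finset.univ := Finset.eq_univ_iff_forall.2 fun i => by simp [hT.2 i]
  rw [← List.toFinset_card_of_nodup hT.1, h, Finset.card_univ, Fintype.card_fin]

end VTree

namespace NNFCircuit

/-- `HasWeight b t j k a`: under `a`, the vtree `t` has `j` true variables, and the variable
number `k` has the value `b` if it occurs in `t`. -/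
def HasWeight {n : ℕ} (b : Bool) (t : VTree (Fin n)) (j k : ℕ) (a : Fin n → Bool) : Prop :=
  t.leaves.countP a = j ∧ ∀ i ∈ t.leaves, (i : ℕ) + 1 = k → a i = b

theorem hasWeight_node {n : ℕ} {b : Bool} {l r : VTree (Fin n)} {j k : ℕ} {a : Fin n → Bool} :
    HasWeight b (.node l r) j k a ↔
      ∃ j₁ j₂, j₁ + j₂ = j ∧ HasWeight b l j₁ k a ∧ HasWeight b r j₂ k a := by
  simp only [HasWeight, VTree.leaves, List.countP_append, List.mem_append]
  constructor
  · rintro ⟨h1, h2⟩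
    exact ⟨_, _, h1, ⟨rfl, fun i hi => h2 i (Or.inl hi)⟩, ⟨rfl, fun i hi => h2 i (Or.inr hi)⟩⟩
  · rintro ⟨j₁, j₂, rfl, ⟨rfl, h1⟩, ⟨rfl, h2⟩⟩
    exact ⟨rfl, fun i hi => hi.elim (h1 i) (h2 i)⟩

/-- The states of the hidden weighted bit rule: `some (j, k)` stands for `HasWeight _ _ j k`, and
`none` for the result at the root. -/
abbrev HWBState (n : ℕ) : Type := Option (Fin (n + 1) × Fin (n + 1))

/-- The pairs of states that may occur below a state. -/
inductive HWBSplit {n : ℕ} (b : Bool) : HWBState n → HWBState n → HWBState n → Prop where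
  | weight (j j₁ j₂ k : Fin (n + 1)) (h : (j₁ : ℕ) + j₂ = j) :
      HWBSplit b (some (j, k)) (some (j₁, k)) (some (j₂, k))
  -- Variable numbers start at 1, so for k = 0 no variable is tested; the side condition `hk`
  -- supplies the value 0 at weight 0.
  | root (j₁ j₂ k : Fin (n + 1)) (h : (j₁ : ℕ) + j₂ = k) (hk : (k : ℕ) = 0 → b = false) :
      HWBSplit b none (some (j₁, k)) (some (j₂, k))

/-- Some assignment satisfies the state at the vtree. -/
def HWBSat {n : ℕ} (b : Bool) (t : VTree (Fin n)) : HWBState n → Prop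
  | some (j, k) => ∃ a, HasWeight b t j k a
  | none => False

open Classical in
/-- The rule that tracks the weight and the tested variable and decides `HWB n a = b`. -/
noncomputable def hwbRule (n : ℕ) (b : Bool) : StateRule (Fin n) (HWBState n) where
  leaf
    | x, some (j, k) =>
      if (j : ℕ) ≤ 1 ∧ ((x : ℕ) + 1 = k → decide ((j : ℕ) = 1) = b) then .inr (decide ((j : ℕ) = 1))
      else .inl false
    | _, none => .inl false
  -- The satisfiability conditions serve smoothness; they do not change the computed function.
  node l r q := Finset.univ.filter fun p =>
    HWBSplit b q p.1 p.2 ∧ HWBSat b l p.1 ∧ HWBSat b r p.2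

variable {n : ℕ} {b : Bool}

theorem holds_hwbRule_some (a : Fin n → Bool) (t : VTree (Fin n)) (j k : Fin (n + 1)) :
    (hwbRule n b).Holds a t (some (j, k)) ↔ HasWeight b t j k a := by
  induction t generalizing j with
  | leaf x =>
    simp only [StateRule.Holds, hwbRule, HasWeight, VTree.leaves, List.countP_singleton,
      List.mem_singleton, forall_eq]
    have hj : (if a x = true then 1 else 0) = (j : ℕ) ↔
        (j : ℕ) ≤ 1 ∧ a x = decide ((j : ℕ) = 1) := by
      cases a x <;> simp <;> omega
    rw [hj]
    by_cases h1 : (j : ℕ) ≤ 1 ∧ ((x : ℕ) + 1 = k → decide ((j : ℕ) = 1) = b)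
    · rw [if_pos h1, Sum.elim_inr]
      exact ⟨fun h => ⟨⟨h1.1, h⟩, h ▸ h1.2⟩, fun h => h.1.2⟩
    · rw [if_neg h1, Sum.elim_inl]
      simp only [Bool.false_eq_true, false_iff]
      exact fun h => h1 ⟨h.1.1, h.1.2 ▸ h.2⟩
  | node l r ihl ihr =>
    rw [hasWeight_node]
    simp only [StateRule.Holds, hwbRule, Finset.mem_filter, Finset.mem_univ, true_and]
    rw [← hwbRule]
    constructor
    · rintro ⟨⟨p₁, p₂⟩, ⟨hs, -⟩, h1, h2⟩
      cases hs with
      | weight _ j₁ j₂ _ h => exact ⟨j₁, j₂, h, (ihl j₁).1 h1, (ihr j₂).1 h2⟩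
    · rintro ⟨j₁, j₂, h, h1, h2⟩
      have hj := j.2
      have e1 := ihl ⟨j₁, by omega⟩
      have e2 := ihr ⟨j₂, by omega⟩
      exact ⟨(some (⟨j₁, by omega⟩, k), some (⟨j₂, by omega⟩, k)),
        ⟨.weight _ _ _ _ h, ⟨a, h1⟩, ⟨a, h2⟩⟩, e1.2 h1, e2.2 h2⟩

theorem holds_hwbRule_none (a : Fin n → Bool) {l r : VTree (Fin n)}
    (hT : (VTree.node l r).IsVTree) :
    (hwbRule n b).Holds a (.node l r) none ↔ HWB n a = b := by
  have hHWB : HWB n a = b ↔ HasWeight b (.node l r) (hammingWeight a) (hammingWeight a) a ∧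
      (hammingWeight a = 0 → b = false) := by
    simp only [HasWeight, hT.countP_leaves, true_and, hT.2, forall_const, HWB]
    have hle : hammingWeight a ≤ n := (Finset.card_le_univ _).trans (by simp)
    cases b with
    | false => simp
    | true =>
      simp only [decide_eq_true_eq, Bool.true_eq_false, imp_false]
      constructor
      · rintro ⟨i, hi, h⟩
        refine ⟨fun i' hi' => ?_, by omega⟩
        rwa [show i' = i from Fin.ext (by omega)]
      · rintro ⟨h1, h2⟩
        exact ⟨⟨hammingWeight a - 1, by omega⟩, by simp only; omega, h1 _ (by simp only; omega)⟩
  rw [hHWB, hasWeight_node]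
  simp only [StateRule.Holds]
  constructor
  · rintro ⟨⟨p₁, p₂⟩, hp, h1, h2⟩
    simp only [hwbRule, Finset.mem_filter, Finset.mem_univ, true_and] at hp
    cases hp.1 with
    | root j₁ j₂ k h hk =>
      rw [holds_hwbRule_some] at h1 h2
      have hw : hammingWeight a = k := by
        rw [← hT.countP_leaves, VTree.leaves, List.countP_append, h1.1, h2.1, h]
      rw [hw]
      exact ⟨⟨j₁, j₂, h, h1, h2⟩, hk⟩
  · rintro ⟨⟨j₁, j₂, h, h1, h2⟩, h0⟩
    have hle : hammingWeight a ≤ n := (Finset.card_le_univ _).trans (by simp)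
    refine ⟨(some (⟨j₁, by omega⟩, ⟨hammingWeight a, by omega⟩),
      some (⟨j₂, by omega⟩, ⟨hammingWeight a, by omega⟩)), ?_,
      (holds_hwbRule_some ..).2 h1, (holds_hwbRule_some ..).2 h2⟩
    simp only [hwbRule, Finset.mem_filter, Finset.mem_univ, true_and]
    exact ⟨.root _ _ _ h h0, ⟨a, h1⟩, ⟨a, h2⟩⟩

/-- The assignment determines its weights on `l` and `r`, and at the root the guess is their sum. -/
theorem exclusive_hwbRule (T : VTree (Fin n)) : (hwbRule n b).Exclusive T := by
  rintro l r - q ⟨p₁, p₂⟩ hp ⟨p₁', p₂'⟩ hp' hne a h1 h2 h1' h2'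
  simp only [hwbRule, Finset.mem_filter, Finset.mem_univ, true_and] at hp hp'
  obtain ⟨hs, -⟩ := hp
  obtain ⟨hs', -⟩ := hp'
  apply hne
  cases hs with
  | weight j j₁ j₂ k h =>
    cases hs' with
    | weight _ j₁' j₂' _ h' =>
      rw [holds_hwbRule_some] at h1 h2 h1' h2'
      rw [Fin.ext (h1.1.symm.trans h1'.1), Fin.ext (h2.1.symm.trans h2'.1)]
  | root j₁ j₂ k h hk =>
    cases hs' with
    | root j₁' j₂' k' h' hk' =>
      rw [holds_hwbRule_some] at h1 h2 h1' h2'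
      obtain rfl := Fin.ext (h1.1.symm.trans h1'.1)
      obtain rfl := Fin.ext (h2.1.symm.trans h2'.1)
      obtain rfl := Fin.ext (h.symm.trans h')
      rfl

theorem trim_hwbRule : (hwbRule n b).Trim := by
  have key : ∀ (t : VTree (Fin n)) q, HWBSat b t q → ∃ a, (hwbRule n b).Holds a t q := by
    rintro t (_ | ⟨j, k⟩) h
    · exact h.elim
    · exact h.imp fun a ha => (holds_hwbRule_some a t j k).2 ha
  constructor
  · rintro x (_ | ⟨j, k⟩)
    · simp [hwbRule]
    · simp only [hwbRule]
      split_ifs <;> simp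
  · intro l r q p hp
    simp only [hwbRule, Finset.mem_filter, Finset.mem_univ, true_and] at hp
    exact ⟨key _ _ hp.2.1, key _ _ hp.2.2⟩

/-- The hidden weighted bit function and its negation have smooth structured d-DNNFs of polynomial
size with respect to every vtree that is not a leaf. -/
theorem exists_structuredDDNNF_HWB {l r : VTree (Fin n)} (hT : (VTree.node l r).IsVTree)
    (b : Bool) :
    ∃ D : NNFCircuit (Fin n), D.IsStructuredDDNNF (.node l r) ∧ D.Smooth ∧
      (∀ a, D.eval a D.out = true ↔ HWB n a = b) ∧
      D.size ≤ 2 * n * (((n + 1) ^ 2 + 1) + ((n + 1) ^ 2 + 1) ^ 2) := by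
  refine ⟨(hwbRule n b).circuit (.node l r) none,
    StateRule.isStructuredDDNNF_circuit _ hT.1 (exclusive_hwbRule _), trim_hwbRule.smooth_circuit,
    fun a => ?_, ?_⟩
  · exact ((hwbRule n b).eval_circuit a _ (VTree.self_mem_subtrees _) none).trans
      (holds_hwbRule_none a hT)
  · refine (StateRule.size_circuit_le _).trans_eq ?_
    rw [hT.length_leaves]
    simp [sq]

end NNFCircuit

/-! ### Many left cofactors of the hidden weighted bit function -/

/-- On an assignment with `j + 1` ones, the hidden weighted bit is the variable `j`. -/
theorem HWB_decide_mem {n : ℕ} (A : Finset (Fin n)) (j : Fin n) (h : A.card = j + 1) :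
    HWB n (fun i => decide (i ∈ A)) = decide (j ∈ A) := by
  have hw : hammingWeight (fun i => decide (i ∈ A)) = j + 1 := by
    rw [← h, hammingWeight]
    congr 1
    ext i
    simp
  rw [HWB, hw]
  simp only [decide_eq_decide, decide_eq_true_eq]
  constructor
  · rintro ⟨i, hi, hA⟩
    rwa [show j = i from Fin.ext (by omega)]
  · exact fun hA => ⟨j, rfl, hA⟩

/-- One of two consecutive windows of `r + 1` indices has `m` elements in common with a set that
misses only `r` indices. -/
theorem exists_subset_window {n r m w : ℕ} (Y : Finset (Fin n)) (hY : Y.card + r = n)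
    (hm : 2 * m ≤ r) (hw : 1 ≤ w) (hn : w + 2 * r + 1 ≤ n) :
    ∃ v, (v = w ∨ v = w + r + 1) ∧ ∃ Z ⊆ Y, Z.card = m ∧ ∀ j ∈ Z, v ≤ j + 1 ∧ (j : ℕ) + 1 ≤ v + r := by
  let W₁ : Finset (Fin n) := Finset.Icc ⟨w - 1, by omega⟩ ⟨w - 1 + r, by omega⟩
  let W₂ : Finset (Fin n) := Finset.Icc ⟨w + r, by omega⟩ ⟨w + 2 * r, by omega⟩
  have h1 : W₁.card = r + 1 := by simp only [W₁, Fin.card_Icc]; omega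
  have h2 : W₂.card = r + 1 := by simp only [W₂, Fin.card_Icc]; omega
  have hd : Disjoint (W₁ \ Y) (W₂ \ Y) := by
    rw [Finset.disjoint_left]
    intro i hi hi'
    simp only [W₁, W₂, Finset.mem_sdiff, Finset.mem_Icc, Fin.le_def] at hi hi'
    omega
  have hc : (W₁ \ Y).card + (W₂ \ Y).card ≤ Yᶜ.card := by
    rw [← Finset.card_union_of_disjoint hd]
    refine Finset.card_le_card fun i hi => ?_
    simp only [Finset.mem_union, Finset.mem_sdiff, Finset.mem_compl] at hi ⊢
    tauto
  have hYc : Yᶜ.card = r := by rw [Finset.card_compl, Fintype.card_fin]; omega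
  have e1 := Finset.card_sdiff_add_card_inter W₁ Y
  have e2 := Finset.card_sdiff_add_card_inter W₂ Y
  -- If both intersections had fewer than `m` elements, the windows would lose more than `r` indices
  -- to the complement of `Y`.
  have : m ≤ (W₁ ∩ Y).card ∨ m ≤ (W₂ ∩ Y).card := by omega
  rcases this with h | h
  · obtain ⟨Z, hZ, hZm⟩ := Finset.exists_subset_card_eq h
    refine ⟨w, Or.inl rfl, Z, hZ.trans Finset.inter_subset_right, hZm, fun j hj => ?_⟩
    have := (Finset.mem_inter.1 (hZ hj)).1
    simp only [W₁, Finset.mem_Icc, Fin.le_def] at this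
    omega
  · obtain ⟨Z, hZ, hZm⟩ := Finset.exists_subset_card_eq h
    refine ⟨_, Or.inr rfl, Z, hZ.trans Finset.inter_subset_right, hZm, fun j hj => ?_⟩
    have := (Finset.mem_inter.1 (hZ hj)).1
    simp only [W₂, Finset.mem_Icc, Fin.le_def] at this
    omega

/-- A family of subsets of `Z` that contains every set or its complement has at least half of the
members of the powerset. -/
theorem two_pow_le_two_mul_card {α : Type} [DecidableEq α] (Z : Finset α) (G : Finset (Finset α))
    (h : ∀ P ⊆ Z, P ∈ G ∨ Z \ P ∈ G) : 2 ^ Z.card ≤ 2 * G.card := by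
  rw [← Finset.card_powerset, two_mul]
  calc Z.powerset.card ≤ (G ∪ G.image (Z \ ·)).card := by
        refine Finset.card_le_card fun P hP => ?_
        rw [Finset.mem_powerset] at hP
        rw [Finset.mem_union, Finset.mem_image]
        exact (h P hP).imp id fun h' => ⟨_, h', by rw [Finset.sdiff_sdiff_eq_self hP]⟩
    _ ≤ G.card + (G.image (Z \ ·)).card := Finset.card_union_le _ _
    _ ≤ G.card + G.card := Nat.add_le_add_left Finset.card_image_le _

/-- Exponentially many patterns on `Z ⊆ Y` extend to subsets of `Y` of one and the same size, from
which every index in `Z` can be reached as the size by adding elements outside `Y`. -/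
theorem exists_patterns {n : ℕ} (hn : 30 ≤ n) (Y : Finset (Fin n)) (hY : Y.card = 6 * n / 10) :
    ∃ Z ⊆ Y, n ≤ 5 * (Z.card + 4) ∧ ∃ G : Finset (Finset (Fin n)), 2 ^ Z.card ≤ 2 * G.card ∧
      3 ≤ G.card ∧ ∃ (A : Finset (Fin n) → Finset (Fin n)) (B : Fin n → Finset (Fin n)),
        (∀ P ∈ G, P ⊆ Z ∧ A P ⊆ Y ∧ A P ∩ Z = P) ∧ (∀ j ∈ Z, B j ⊆ Yᶜ) ∧
          ∀ P ∈ G, ∀ j ∈ Z, (A P).card + (B j).card = j + 1 := by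
  obtain ⟨r, hr⟩ : ∃ r, r = n - 6 * n / 10 := ⟨_, rfl⟩
  -- A window guarantees r/2 elements. Padding in the upper window needs r + 1 + m ≤ |Y|, where 3r/2
  -- is already about |Y|; the 3 absorbs the rounding.
  obtain ⟨m, hm⟩ : ∃ m, m = r / 2 - 3 := ⟨_, rfl⟩
  obtain ⟨v, hv, Z, hZY, hZm, hZ⟩ := exists_subset_window (r := r) (m := m) (w := m / 2) Y
    (by omega) (by omega) (by omega) (by omega)
  have hYZ : (Y \ Z).card = 6 * n / 10 - m := by rw [Finset.card_sdiff_of_subset hZY, hY, hZm]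
  have hYc : Yᶜ.card = r := by rw [Finset.card_compl, Fintype.card_fin, hY, hr]
  -- The patterns that can be padded from `Y \ Z` to size exactly `v`.
  let G := Z.powerset.filter fun P => P.card ≤ v ∧ v ≤ P.card + (6 * n / 10 - m)
  have hG : 2 ^ Z.card ≤ 2 * G.card := by
    -- For v = m/2 the smaller of P and Z \ P can be padded, for v = m/2 + r + 1 the larger.
    refine two_pow_le_two_mul_card Z G fun P hP => ?_
    have hPm := Finset.card_le_card hP
    simp only [G, Finset.mem_filter, Finset.mem_powerset, hP, Finset.sdiff_subset, true_and,
      Finset.card_sdiff_of_subset hP, hZm]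
    omega
  have hA : ∀ P ∈ G, ∃ Q ⊆ Y \ Z, Q.card = v - P.card := by
    intro P hP
    simp only [G, Finset.mem_filter] at hP
    exact Finset.exists_subset_card_eq (by omega)
  have hB : ∀ j ∈ Z, ∃ Q ⊆ Yᶜ, Q.card = j + 1 - v := by
    intro j hj
    have := hZ j hj
    exact Finset.exists_subset_card_eq (by omega)
  choose! A hA hAc using hA
  choose! B hB hBc using hB
  have hdisj : ∀ P ∈ G, Disjoint (A P) Z := fun P hP =>
    Finset.disjoint_of_subset_left (hA P hP) Finset.sdiff_disjoint
  refine ⟨Z, hZY, by omega, G, hG, ?_, fun P => P ∪ A P, B, ?_, hB, ?_⟩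
  · have : 2 ^ 3 ≤ 2 ^ Z.card := Nat.pow_le_pow_right (by norm_num) (by omega)
    omega
  · intro P hP
    have hPZ : P ⊆ Z := Finset.mem_powerset.1 (Finset.mem_filter.1 hP).1
    refine ⟨hPZ, Finset.union_subset (hPZ.trans hZY) ((hA P hP).trans Finset.sdiff_subset), ?_⟩
    rw [Finset.union_inter_distrib_right, Finset.inter_eq_left.2 hPZ,
      Finset.disjoint_iff_inter_eq_empty.1 (hdisj P hP), Finset.union_empty]
  · intro P hP j hj
    have hP' := Finset.mem_filter.1 hP
    have hPZ : P ⊆ Z := Finset.mem_powerset.1 hP'.1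
    have := hZ j hj
    rw [Finset.card_union_of_disjoint
      (Finset.disjoint_of_subset_left hPZ (hdisj P hP).symm), hAc P hP, hBc j hj]
    omega

theorem exists_isHWBVTree {n : ℕ} (hn : 2 ≤ n) : ∃ T : VTree (Fin n), IsHWBVTree n T := by
  have key : ∀ l : List (Fin n), l ≠ [] → ∃ T : VTree (Fin n), T.RightLinear ∧ T.leaves = l := by
    intro l
    induction l with
    | nil => exact fun h => absurd rfl h
    | cons x l ih =>
      intro _
      rcases eq_or_ne l [] with rfl | hl
      · exact ⟨.leaf x, trivial, rfl⟩
      · obtain ⟨T, hT, rfl⟩ := ih hl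
        exact ⟨.node (.leaf x) T, ⟨⟨x, rfl⟩, hT⟩, rfl⟩
  have hlen : (List.finRange n).length = n := List.length_finRange
  -- Both parts of the list are nonempty since n ≥ 2.
  obtain ⟨L, hL, hL'⟩ := key ((List.finRange n).take (6 * n / 10)) fun h => by
    have := congrArg List.length h
    simp at this
    omega
  obtain ⟨R, hR, hR'⟩ := key ((List.finRange n).drop (6 * n / 10)) fun h => by
    have := congrArg List.length h
    simp at this
    omega
  have hleaves : (VTree.node L R).leaves = List.finRange n := by
    rw [VTree.leaves, hL', hR', List.take_append_drop]
  refine ⟨.node L R, ⟨?_, fun i => ?_⟩, L, R, rfl, hL, hR, ?_⟩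
  · rw [hleaves]; exact List.nodup_finRange n
  · rw [hleaves]; exact List.mem_finRange i
  · rw [hL', List.length_take, hlen]; omega

/-- The lower bound on the size of sentential decision diagrams of the hidden weighted bit
function. -/
theorem exists_two_pow_le_size_of_isSDD_HWB {n : ℕ} (hn : 30 ≤ n) {L R : VTree (Fin n)}
    (hT : (VTree.node L R).IsVTree) (hL : L.leaves.length = 6 * n / 10) :
    ∃ m : ℕ, n ≤ 5 * (m + 4) ∧ ∀ S : NNFCircuit (Fin n), S.IsSDD (.node L R) →
      S.Represents (HWB n) → 2 ^ m ≤ 2 * S.size := by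
  classical
  have hLR : Disjoint L.vars R.vars :=
    VTree.disjoint_vars_of_mem_subtrees hT.1 (VTree.self_mem_subtrees _)
  have hmem : ∀ i, i ∈ L.leaves.toFinset ↔ i ∈ L.vars := fun i => List.mem_toFinset
  have hY : L.leaves.toFinset.card = 6 * n / 10 := by
    rw [List.toFinset_card_of_nodup (List.nodup_append'.1 hT.1).1, hL]
  obtain ⟨Z, hZY, hZ, G, hG, hG3, A, B, hA, hB, hAB⟩ := exists_patterns hn _ hY
  have hdisj : ∀ P ∈ G, ∀ j ∈ Z, Disjoint (A P) (B j) := fun P hP j hj =>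
    disjoint_compl_right.mono (hA P hP).2.1 (hB j hj)
  have hmemA : ∀ P ∈ G, ∀ j ∈ Z, j ∈ A P ↔ j ∈ P := fun P hP j hj => by
    rw [← (hA P hP).2.2, Finset.mem_inter]
    have := (hA P hP).2.2
    simp [hj, this]
  have hHWB : ∀ P ∈ G, ∀ j ∈ Z, HWB n (fun i => decide (i ∈ A P ∪ B j)) = decide (j ∈ P) := by
    intro P hP j hj
    rw [HWB_decide_mem _ j
      (by rw [Finset.card_union_of_disjoint (hdisj P hP j hj), hAB P hP j hj])]
    have : j ∉ B j := fun h => Finset.mem_compl.1 (hB j hj h) (hZY hj)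
    simp only [Finset.mem_union, this, or_false, hmemA P hP j hj]
  have hpw : ∀ P ∈ G, ∀ j ∈ Z,
      L.vars.piecewise (fun i => decide (i ∈ A P)) (fun i => decide (i ∈ B j)) =
        fun i => decide (i ∈ A P ∪ B j) := by
    intro P hP j hj
    ext i
    by_cases hi : i ∈ L.vars
    · have : i ∉ B j := fun h => Finset.mem_compl.1 (hB j hj h) ((hmem i).2 hi)
      simp [hi, this]
    · have : i ∉ A P := fun h => hi ((hmem i).1 ((hA P hP).2.1 h))
      simp [hi, this]
  have hne : ∀ P ∈ G, ∀ Q ∈ G, P ≠ Q → ∃ j ∈ Z, decide (j ∈ P) ≠ decide (j ∈ Q) := by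
    intro P hP Q hQ hPQ
    by_contra! h
    refine hPQ (Finset.ext fun j => ?_)
    by_cases hj : j ∈ Z
    · simpa using h j hj
    · exact iff_of_false (fun h => hj ((hA P hP).1 h)) (fun h => hj ((hA Q hQ).1 h))
  refine ⟨Z.card, hZ, fun S hS hrep => hG.trans (Nat.mul_le_mul_left 2 ?_)⟩
  refine hS.card_le_size hLR hrep ?_ ?_ G (fun P i => decide (i ∈ A P)) ?_
  · intro hdep
    -- A pattern other than ∅ and Z has some j ∈ P and k ∈ Z \ P. The right parts `B j` and `B k`
    -- then give different values with the same left part `A P`.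
    obtain ⟨P, hP, hP0⟩ : ∃ P ∈ G, P ∉ ({∅, Z} : Finset (Finset (Fin n))) := by
      by_contra! h
      have := Finset.card_le_card (show G ⊆ {∅, Z} from h)
      have := Finset.card_le_two (a := (∅ : Finset (Fin n))) (b := Z)
      omega
    simp only [Finset.mem_insert, Finset.mem_singleton, not_or] at hP0
    obtain ⟨j, hj⟩ := Finset.nonempty_iff_ne_empty.2 hP0.1
    obtain ⟨k, hk, hkP⟩ := Finset.exists_of_ssubset ((hA P hP).1.ssubset_of_ne hP0.2)
    have hjZ := (hA P hP).1 hj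
    have := hdep (x := fun i => decide (i ∈ A P ∪ B j)) (y := fun i => decide (i ∈ A P ∪ B k))
      fun i hi => by
        rw [← congrFun (hpw P hP j hjZ) i, ← congrFun (hpw P hP k hk) i]
        simp [hi]
    rw [hHWB P hP j hjZ, hHWB P hP k hk] at this
    simp [hj, hkP] at this
  · intro hdep
    -- Two patterns that differ at j give different values with the same right part `B j`.
    obtain ⟨P, hP, Q, hQ, hPQ⟩ := Finset.one_lt_card.1 (show 1 < G.card by omega)
    obtain ⟨j, hj, hjne⟩ := hne P hP Q hQ hPQ
    refine hjne ?_
    rw [← hHWB P hP j hj, ← hHWB Q hQ j hj, ← hpw P hP j hj, ← hpw Q hQ j hj]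
    refine hdep fun i hi => ?_
    have hi' : i ∉ L.vars := Set.disjoint_right.1 hLR hi
    simp [hi']
  · intro P hP Q hQ hPQ
    obtain ⟨j, hj, hjne⟩ := hne P hP Q hQ hPQ
    refine ⟨fun i => decide (i ∈ B j), ?_⟩
    rwa [hpw P hP j hj, hpw Q hQ j hj, hHWB P hP j hj, hHWB Q hQ j hj]

/-! ### The proposition -/

theorem mainTheorem3 :
    ∃ (q : Polynomial ℕ) (c : ℝ), 0 < c ∧ ∀ n : ℕ, 2 ≤ n →
      (∃ T : VTree (Fin n), IsHWBVTree n T) ∧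
      ∀ T : VTree (Fin n), IsHWBVTree n T →
        (∃ D : NNFCircuit (Fin n), D.IsStructuredDDNNF T ∧ D.Smooth ∧
          D.Represents (HWB n) ∧ D.size ≤ q.eval n) ∧
        (∃ D : NNFCircuit (Fin n), D.IsStructuredDDNNF T ∧ D.Smooth ∧
          D.Represents (fun a => !(HWB n a)) ∧ D.size ≤ q.eval n) ∧
        (∃ S : NNFCircuit (Fin n), S.IsSDD T ∧ S.Represents (HWB n)) ∧
        (∀ S : NNFCircuit (Fin n), S.IsSDD T → S.Represents (HWB n) →
          c * (2 : ℝ) ^ ((n : ℝ) / 5) ≤ (S.size : ℝ)) := by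
  -- The polynomial is the bound in `exists_structuredDDNNF_HWB`. For n < 30 the constant 1/64 works
  -- as 2^(n/5) ≤ 2^6 and the size is at least 1; for n ≥ 30, 2^(n/5) ≤ 2^(m+4) is at most 32 times
  -- the size.
  refine ⟨2 * .X * (((.X + 1) ^ 2 + 1) + ((.X + 1) ^ 2 + 1) ^ 2), 1 / 64, by norm_num,
    fun n hn => ⟨exists_isHWBVTree hn, ?_⟩⟩
  rintro T ⟨hT, L, R, rfl, -, -, hL⟩
  refine ⟨?_, ?_, ?_, ?_⟩
  · obtain ⟨D, h1, h2, h3, h4⟩ := NNFCircuit.exists_structuredDDNNF_HWB hT true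
    exact ⟨D, h1, h2, fun a => Bool.eq_iff_iff.2 (h3 a), by simpa using h4⟩
  · obtain ⟨D, h1, h2, h3, h4⟩ := NNFCircuit.exists_structuredDDNNF_HWB hT false
    exact ⟨D, h1, h2, fun a => Bool.eq_iff_iff.2 ((h3 a).trans (by simp)), by simpa using h4⟩
  · exact NNFCircuit.exists_isSDD _ _ fun a b h => congrArg _ (funext fun i => h i (hT.2 i))
  · intro S hS hrep
    have hexp : ∀ k : ℕ, n ≤ 5 * k → (2 : ℝ) ^ ((n : ℝ) / 5) ≤ 2 ^ k := by
      intro k hk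
      rw [← Real.rpow_natCast]
      refine Real.rpow_le_rpow_of_exponent_le (by norm_num) ?_
      have : (n : ℝ) ≤ 5 * k := by exact_mod_cast hk
      linarith
    rcases le_or_gt 30 n with h30 | h30
    · obtain ⟨m, hm, hsize⟩ := exists_two_pow_le_size_of_isSDD_HWB h30 hT hL
      have h1 : (2 : ℝ) ^ m ≤ 2 * S.size := by exact_mod_cast hsize S hS hrep
      have h2 := hexp (m + 4) hm
      rw [pow_add] at h2
      linarith
    · have h1 := hexp 6 (by omega)
      have := S.finite
      have : Nonempty S.V := ⟨S.out⟩
      have h2 : (1 : ℝ) ≤ S.size := by exact_mod_cast Nat.card_pos (α := S.V)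
      linarith
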